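/- Let $G=(V(G),E(G))$ be a connected simple undirected graph, finite or infinite, in which every vertex has finite degree (the degrees need not be bounded). Let $L_2(G)$ be the Hilbert space of functions $f:V(G)\to\mathbb C$ with $\|f\|^2=\sum_{v}|f(v)|^2<\infty$, and let $L$ be the (possibly unbounded) Laplace operator $$Lf(v)=\sum_{u\sim v}\bigl(f(v)-f(u)\bigr),$$ with domain $\{f\in L_2(G): Lf\in L_2(G)\}$; it is a nonnegative self-adjoint operator. For $\omega\in\mathbb R$ let $PW_\omega(L)$ be the set of all $f\in L_2(G)$ whose spectral Fourier transform is supported in $[0,\omega]$; here a spectral Fourier transform is a unitary operator from $L_2(G)$ onto a direct integral of Hilbert spaces over $[0,\infty)$ that carries $L$ (with its domain) to multiplication by the spectral variable $\lambda$ (with its maximal domain), and $PW_\omega(L)$ does not depend on which one is used. For $S\subset V(G)$ let $bS$ be the set of vertices outside $S$ that are adjacent to a vertex of $S$. Suppose that $S\cup bS=V(G)$ and that, for some integer $K_0\ge 1$, every vertex of $bS$ is adjacent to at least $K_0$ vertices of $S$. If $\omega<K_0/4$, then: 1. $S$ is a uniqueness set for $PW_\omega(L)$: if $f,g\in PW_\omega(L)$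 and $f(u)=g(u)$ for all $u\in S$, then $f=g$. 2. There exist functions $\Theta_u\in PW_\omega(L)$, $u\in S$, such that for every $f\in PW_\omega(L)$ $$f=\sum_{u\in S}f(u)\,\Theta_u,$$ where the series converges unconditionally in the norm of $L_2(G)$. -/

import Mathlib

open MeasureTheory Filter Topology
open scoped NNReal ENNReal ComplexConjugate InnerProductSpace

namespace GraphSampling

universe u

/-- The Hilbert space of square-summable complex functions on the vertex set. -/
abbrev L2 (V : Type u) : Type u := lp (fun _ : V => ℂ) 2

section Laplacian

variable {V : Type u} (G : SimpleGraph V) [G.LocallyFinite]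

/-- The Laplace operator `D - A` on all functions:
`(L f)(v) = ∑_{u ∼ v} (f(v) - f(u))`. -/
def lapFun : (V → ℂ) →ₗ[ℂ] (V → ℂ) where
  toFun f v := ∑ w ∈ G.neighborFinset v, (f v - f w)
  map_add' f g := by
    funext v
    simp only [Pi.add_apply, ← Finset.sum_add_distrib]
    exact Finset.sum_congr rfl fun _ _ => by ring
  map_smul' c f := by
    funext v
    simp only [Pi.smul_apply, smul_eq_mul, RingHom.id_apply, Finset.mul_sum]
    exact Finset.sum_congr rfl fun _ _ => by ring

/-- The Laplace operator as an (in general unbounded) operator in the Hilbert space of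
square-summable functions, with domain all `f` such that `L f` is square-summable. -/
def laplacian : L2 V →ₗ.[ℂ] L2 V where
  domain :=
    { carrier := {f | Memℓp (lapFun G f) 2}
      add_mem' := fun {f g} hf hg => by
        simp only [Set.mem_ofPred_eq, lp.coeFn_add, map_add]
        exact Memℓp.add hf hg
      zero_mem' := by
        simp only [Set.mem_ofPred_eq, lp.coeFn_zero, map_zero]
        exact zero_memℓp
      smul_mem' := fun c f hf => by
        simp only [Set.mem_ofPred_eq, lp.coeFn_smul, map_smul]
        exact Memℓp.const_smul hf c }
  toFun :=
    { toFun := fun f => ⟨lapFun G f, f.2⟩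
      map_add' := fun f g => by
        ext v
        exact congrFun ((lapFun G).map_add ⇑(f : L2 V) ⇑(g : L2 V)) v
      map_smul' := fun c f => by
        ext v
        exact congrFun ((lapFun G).map_smul c ⇑(f : L2 V)) v }

theorem mem_laplacian_domain {f : L2 V} : f ∈ (laplacian G).domain ↔ Memℓp (lapFun G f) 2 :=
  Iff.rfl

theorem laplacian_apply (f : (laplacian G).domain) (v : V) :
    laplacian G f v = ∑ w ∈ G.neighborFinset v, ((f : L2 V) v - (f : L2 V) w) := rfl

/-- Maximum principle: `-1` is not an eigenvalue of the Laplacian. -/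
theorem eq_zero_of_add_lapFun_eq_zero (f : L2 V)
    (h : ∀ v, f v + lapFun G f v = 0) : f = 0 := by
  by_contra hf
  have hex : ∃ v, f v ≠ 0 := by
    by_contra hno
    push Not at hno
    exact hf (by ext v; simpa using hno v)
  obtain ⟨v₀, hv₀⟩ := hex
  have hs : Summable fun v => ‖f v‖ ^ (2 : ℝ) := by
    have := (lp.memℓp f).summable (by norm_num)
    simpa using this
  have hfin : {v | ‖f v₀‖ ≤ ‖f v‖}.Finite := by
    have h0 := hs.tendsto_cofinite_zero
    have hpos : 0 < ‖f v₀‖ ^ (2 : ℝ) := Real.rpow_pos_of_pos (norm_pos_iff.2 hv₀) _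
    have := (h0.eventually (gt_mem_nhds hpos))
    refine (Filter.eventually_cofinite.1 this).subset fun v hv => ?_
    simp only [Set.mem_ofPred_eq, not_lt]
    exact Real.rpow_le_rpow (norm_nonneg _) hv (by norm_num)
  obtain ⟨m, hm, hmax⟩ := hfin.toFinset.exists_max_image (fun v => ‖f v‖) ⟨v₀, by simp⟩
  have hm0 : ‖f v₀‖ ≤ ‖f m‖ := by simpa using hm
  have hM : ∀ v, ‖f v‖ ≤ ‖f m‖ := fun v => by
    by_cases hv : ‖f v₀‖ ≤ ‖f v‖
    · exact hmax v (by simpa using hv)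
    · exact (not_le.1 hv).le.trans hm0
  have hpos : 0 < ‖f m‖ := (norm_pos_iff.2 hv₀).trans_le hm0
  have h1 := h m
  have h2 : ((G.neighborFinset m).card + 1 : ℂ) * f m = ∑ w ∈ G.neighborFinset m, f w := by
    have : lapFun G f m = (G.neighborFinset m).card * f m - ∑ w ∈ G.neighborFinset m, f w := by
      simp [lapFun, Finset.sum_sub_distrib]
    rw [this] at h1
    linear_combination h1
  have h3 : ((G.neighborFinset m).card + 1 : ℝ) * ‖f m‖ ≤ (G.neighborFinset m).card * ‖f m‖ := by
    calc ((G.neighborFinset m).card + 1 : ℝ) * ‖f m‖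
        = ‖((G.neighborFinset m).card + 1 : ℂ) * f m‖ := by
          rw [norm_mul]; congr 1
          have : ((G.neighborFinset m).card + 1 : ℂ) = (((G.neighborFinset m).card + 1 : ℕ) : ℂ) := by
            push_cast; ring
          rw [this, Complex.norm_natCast]; push_cast; ring
      _ = ‖∑ w ∈ G.neighborFinset m, f w‖ := by rw [h2]
      _ ≤ ∑ w ∈ G.neighborFinset m, ‖f w‖ := norm_sum_le _ _
      _ ≤ ∑ w ∈ G.neighborFinset m, ‖f m‖ := Finset.sum_le_sum fun w _ => hM w
      _ = _ := by simp
  nlinarith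

/-- Finitely supported functions as elements of the Hilbert space. -/
def finIncl (V : Type u) : (V →₀ ℂ) →ₗ[ℂ] L2 V where
  toFun f := ⟨(f : V → ℂ), (memℓp_zero (by
    refine f.support.finite_toSet.subset fun v hv => ?_
    simpa using hv)).of_exponent_ge (by simp)⟩
  map_add' f g := by ext; rfl
  map_smul' c f := by ext; rfl

@[simp] theorem finIncl_apply (f : V →₀ ℂ) (v : V) : finIncl V f v = f v := rfl

theorem lapFun_finsupp_support (f : V →₀ ℂ) : (Function.support (lapFun G f)).Finite := by
  classical
  refine (f.support ∪ f.support.biUnion fun v => G.neighborFinset v).finite_toSet.subset ?_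
  intro v hv
  by_contra hn
  simp only [Finset.coe_union, Finset.coe_biUnion, Set.mem_union, Set.mem_iUnion,
    Finset.mem_coe, not_or, not_exists] at hn
  refine hv (Finset.sum_eq_zero fun w hw => ?_)
  have h1 : f v = 0 := by simpa using hn.1
  have h2 : f w = 0 := by
    by_contra h
    refine hn.2 w (by simpa using h) ?_
    have := (G.mem_neighborFinset v w).1 hw
    exact (G.mem_neighborFinset w v).2 this.symm
  rw [h1, h2, sub_zero]

/-- The Laplacian on finitely supported functions. -/
def finLap : (V →₀ ℂ) →ₗ[ℂ] L2 V where
  toFun f := ⟨lapFun G f, (memℓp_zero (lapFun_finsupp_support G f)).of_exponent_ge (by simp)⟩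
  map_add' f g := by ext v; exact congrFun (map_add (lapFun G) (f : V → ℂ) g) v
  map_smul' c f := by ext v; exact congrFun (map_smul (lapFun G) c (f : V → ℂ)) v

@[simp] theorem finLap_apply (f : V →₀ ℂ) (v : V) : finLap G f v = lapFun G f v := rfl

theorem inner_finLap_single (x : V) (h : L2 V) :
    ⟪finLap G (Finsupp.single x 1), h⟫_ℂ = lapFun G h x := by
  classical
  have key : finLap G (Finsupp.single x 1) =
      ∑ w ∈ G.neighborFinset x, (lp.single 2 x (1 : ℂ) - lp.single 2 w (1 : ℂ)) := by
    ext v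
    simp only [finLap_apply, lapFun, LinearMap.coe_mk, AddHom.coe_mk, lp.coeFn_sum,
      Finset.sum_apply, lp.coeFn_sub, Pi.sub_apply, lp.coeFn_single, Finset.sum_sub_distrib]
    by_cases hv : v = x
    · subst hv
      refine congrArg₂ _ (by simp) ?_
      · refine Finset.sum_congr rfl fun w hw => ?_
        have := (G.mem_neighborFinset v w).1 hw
        rw [Finsupp.single_eq_of_ne this.ne', Pi.single_eq_of_ne this.ne]
    · simp only [Finsupp.single_eq_of_ne hv, Pi.single_eq_of_ne hv]
      congr 1
      · simp
      · simp only [Finsupp.single_apply, Pi.single_apply]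
        simp [SimpleGraph.adj_comm]
  rw [key, sum_inner]
  refine Finset.sum_congr rfl fun w _ => ?_
  rw [inner_sub_left, lp.inner_single_left, lp.inner_single_left]
  simp

theorem inner_finIncl_single (x : V) (h : L2 V) :
    ⟪finIncl V (Finsupp.single x 1), h⟫_ℂ = h x := by
  classical
  have : finIncl V (Finsupp.single x 1) = lp.single 2 x (1 : ℂ) := by
    ext v
    simp [Finsupp.single_apply, Pi.single_apply, eq_comm]
  rw [this, lp.inner_single_left]
  simp

theorem finLap_symm (f g : V →₀ ℂ) :
    ⟪finLap G f, finIncl V g⟫_ℂ = ⟪finIncl V f, finLap G g⟫_ℂ := by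
  induction f using Finsupp.induction_linear with
  | zero => simp
  | add f₁ f₂ h₁ h₂ => simp only [map_add, inner_add_left, h₁, h₂]
  | single x c =>
    have : Finsupp.single x c = c • Finsupp.single x (1 : ℂ) := by simp
    rw [this, map_smul, map_smul, inner_smul_left, inner_smul_left, inner_finLap_single,
      inner_finIncl_single, finLap_apply]
    congr 2

theorem finLap_nonneg (f : V →₀ ℂ) : 0 ≤ (⟪finIncl V f, finLap G f⟫_ℂ).re := by
  classical
  have h1 : ⟪finIncl V f, finLap G f⟫_ℂ =
      ∑ v ∈ f.support, conj (f v) * lapFun G f v := by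
    have hf : finIncl V f = ∑ v ∈ f.support, lp.single 2 v (f v) := by
      ext w
      rw [lp.coeFn_sum, Finset.sum_apply, finIncl_apply]
      simp [Pi.single_apply]
    rw [hf, sum_inner]
    refine Finset.sum_congr rfl fun v _ => ?_
    rw [lp.inner_single_left]
    simp [mul_comm]
  rw [h1, Complex.re_sum]
  have h2 : ∀ v ∈ f.support, ∑ w ∈ G.neighborFinset v, (‖f v‖ ^ 2 - ‖f w‖ ^ 2) / 2 ≤
      (conj (f v) * lapFun G f v).re := by
    intro v _
    have : conj (f v) * lapFun G f v =
      ∑ w ∈ G.neighborFinset v, (conj (f v) * (f v - f w)) := by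
      simp only [lapFun, LinearMap.coe_mk, AddHom.coe_mk, Finset.mul_sum]
    rw [this, Complex.re_sum]
    refine Finset.sum_le_sum fun w _ => ?_
    have e1 : (conj (f v) * (f v - f w)).re = ‖f v‖ ^ 2 - (conj (f v) * f w).re := by
      rw [mul_sub, Complex.sub_re, ← Complex.normSq_eq_conj_mul_self, Complex.ofReal_re,
        Complex.normSq_eq_norm_sq]
    have e2 : (conj (f v) * f w).re ≤ ‖f v‖ * ‖f w‖ := by
      refine (Complex.re_le_norm _).trans ?_
      simp
    rw [e1]
    nlinarith [sq_nonneg (‖f v‖ - ‖f w‖)]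
  refine le_trans ?_ (Finset.sum_le_sum h2)
  have h3 : ∑ v ∈ f.support, ∑ w ∈ G.neighborFinset v, ‖f w‖ ^ 2 ≤
      ∑ v ∈ f.support, ∑ w ∈ G.neighborFinset v, ‖f v‖ ^ 2 := by
    have l : ∀ v, ∑ w ∈ G.neighborFinset v, ‖f w‖ ^ 2 =
        ∑ w ∈ f.support, if G.Adj v w then ‖f w‖ ^ 2 else 0 := by
      intro v
      rw [← Finset.sum_filter]
      symm
      refine Finset.sum_subset_zero_on_sdiff (fun w hw => ?_) (fun w hw => ?_) fun _ _ => rfl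
      · simpa using (Finset.mem_filter.1 hw).2
      · simp only [Finset.mem_sdiff, SimpleGraph.mem_neighborFinset, Finset.mem_filter,
          Finsupp.mem_support_iff, not_and] at hw
        by_contra h
        refine hw.2 (fun h0 => h ?_) hw.1
        simp [h0]
    simp_rw [l]
    rw [Finset.sum_comm]
    refine Finset.sum_le_sum fun w _ => ?_
    rw [← Finset.sum_filter]
    refine Finset.sum_le_sum_of_subset_of_nonneg (fun v hv => ?_) fun _ _ _ => by positivity
    simpa [SimpleGraph.adj_comm] using (Finset.mem_filter.1 hv).2
  have h4 : ∑ v ∈ f.support, ∑ w ∈ G.neighborFinset v, (‖f v‖ ^ 2 - ‖f w‖ ^ 2) / 2 =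
      (∑ v ∈ f.support, ∑ w ∈ G.neighborFinset v, ‖f v‖ ^ 2 -
        ∑ v ∈ f.support, ∑ w ∈ G.neighborFinset v, ‖f w‖ ^ 2) / 2 := by
    rw [← Finset.sum_sub_distrib, Finset.sum_div]
    refine Finset.sum_congr rfl fun v _ => ?_
    rw [← Finset.sum_sub_distrib, Finset.sum_div]
  rw [h4]
  linarith

theorem norm_finIncl_le (f : V →₀ ℂ) : ‖finIncl V f‖ ≤ 1 * ‖(finIncl V + finLap G) f‖ := by
  have h := finLap_nonneg G f
  have h1 : ‖finIncl V f‖ ^ 2 ≤ ‖finIncl V f‖ * ‖(finIncl V + finLap G) f‖ := by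
    calc ‖finIncl V f‖ ^ 2 ≤ (⟪finIncl V f, (finIncl V + finLap G) f⟫_ℂ).re := by
          rw [LinearMap.add_apply, inner_add_right, Complex.add_re]
          have := inner_self_eq_norm_sq (𝕜 := ℂ) (finIncl V f)
          simp only [RCLike.re_to_complex] at this
          linarith
      _ ≤ _ := (Complex.re_le_norm _).trans (norm_inner_le_norm _ _)
  rcases (norm_nonneg (finIncl V f)).eq_or_lt with h0 | h0
  · rw [← h0]; positivity
  · rw [one_mul]; nlinarith

theorem denseRange_finIncl_add_finLap : DenseRange (finIncl V + finLap G) := by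
  have : (LinearMap.range (finIncl V + finLap G))ᗮ = ⊥ := by
    rw [Submodule.eq_bot_iff]
    intro h hh
    refine eq_zero_of_add_lapFun_eq_zero G h fun v => ?_
    have := (Submodule.mem_orthogonal _ _).1 hh _
      (LinearMap.mem_range_self (finIncl V + finLap G) (Finsupp.single v 1))
    rwa [LinearMap.add_apply, inner_add_left, inner_finIncl_single, inner_finLap_single] at this
  have h2 := (Submodule.topologicalClosure_eq_top_iff).2 this
  have h3 := (Submodule.dense_iff_topologicalClosure_eq_top).2 h2
  rw [DenseRange, ← LinearMap.coe_range]
  exact h3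

/-- The bounded operator `(1 + L)⁻¹`. -/
noncomputable def resolvent : L2 V →L[ℂ] L2 V :=
  (finIncl V).extendOfNorm (finIncl V + finLap G)

theorem resolvent_apply_fin (f : V →₀ ℂ) :
    resolvent G ((finIncl V + finLap G) f) = finIncl V f :=
  LinearMap.extendOfNorm_eq (denseRange_finIncl_add_finLap G) ⟨1, norm_finIncl_le G⟩ f

theorem norm_resolvent_le : ‖resolvent G‖ ≤ 1 :=
  LinearMap.opNorm_extendOfNorm_le (denseRange_finIncl_add_finLap G) zero_le_one
    (norm_finIncl_le G)

theorem resolvent_isPositive : (resolvent G).IsPositive := by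
  have hsymm : ∀ f g, ⟪resolvent G f, g⟫_ℂ = ⟪f, resolvent G g⟫_ℂ := by
    intro f g
    refine (denseRange_finIncl_add_finLap G).induction_on₂
      (p := fun f g => ⟪resolvent G f, g⟫_ℂ = ⟪f, resolvent G g⟫_ℂ) ?_ ?_ f g
    · exact isClosed_eq (by fun_prop) (by fun_prop)
    · intro a b
      rw [resolvent_apply_fin, resolvent_apply_fin]
      simp only [LinearMap.add_apply, inner_add_left, inner_add_right, finLap_symm]
  rw [ContinuousLinearMap.isPositive_def']
  refine ⟨?_, fun f => ?_⟩
  · rw [ContinuousLinearMap.isSelfAdjoint_iff_isSymmetric]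
    exact hsymm
  · refine (denseRange_finIncl_add_finLap G).induction_on
      (p := fun f => 0 ≤ (resolvent G).reApplyInnerSelf f) f ?_ ?_
    · exact isClosed_le continuous_const (resolvent G).reApplyInnerSelf_continuous
    · intro a
      rw [ContinuousLinearMap.reApplyInnerSelf_apply, resolvent_apply_fin, LinearMap.add_apply,
        inner_add_right, map_add]
      exact add_nonneg inner_self_nonneg (finLap_nonneg G a)

theorem resolvent_add_lapFun (f : L2 V) (v : V) :
    resolvent G f v + lapFun G (resolvent G f) v = f v := by
  have hc : ∀ v, Continuous fun f : L2 V => f v := fun v =>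
    (continuous_apply v).comp (lp.uniformContinuous_coe (p := 2)
      (E := fun _ : V => ℂ)).continuous
  refine (denseRange_finIncl_add_finLap G).induction_on
      (p := fun f => resolvent G f v + lapFun G (resolvent G f) v = f v) f ?_ ?_
  · refine isClosed_eq (((hc v).comp (resolvent G).continuous).add ?_) (hc v)
    refine continuous_finsetSum _ fun w _ => ?_
    exact ((hc v).comp (resolvent G).continuous).sub ((hc w).comp (resolvent G).continuous)
  · intro a
    rw [resolvent_apply_fin, LinearMap.add_apply, lp.coeFn_add, Pi.add_apply, finLap_apply]
    congr 1

theorem resolvent_mem_domain (f : L2 V) : resolvent G f ∈ (laplacian G).domain := by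
  have : lapFun G (resolvent G f) = (f - resolvent G f : L2 V) := by
    funext v
    have := resolvent_add_lapFun G f v
    simp only [lp.coeFn_sub, Pi.sub_apply]
    linear_combination this
  rw [mem_laplacian_domain, this]
  exact lp.memℓp _

theorem resolvent_right (f : L2 V) :
    resolvent G f + laplacian G ⟨resolvent G f, resolvent_mem_domain G f⟩ = f := by
  ext v
  exact resolvent_add_lapFun G f v

theorem resolvent_left (f : (laplacian G).domain) :
    resolvent G ((f : L2 V) + laplacian G f) = f := by
  rw [← sub_eq_zero]
  refine eq_zero_of_add_lapFun_eq_zero G _ fun v => ?_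
  have h := resolvent_add_lapFun G ((f : L2 V) + laplacian G f) v
  have h2 : ((f : L2 V) + laplacian G f : L2 V) v = (f : L2 V) v + lapFun G (f : L2 V) v := rfl
  simp only [lp.coeFn_sub, map_sub, Pi.sub_apply]
  rw [h2] at h
  linear_combination h

end Laplacian
/-- A spectral Fourier transform of a nonnegative self-adjoint operator `A`: a unitary operator
from `H` onto a direct integral of Hilbert spaces over the spectral variable `t ∈ [0, ∞)`, given
concretely as the Hilbert direct sum of spaces `L²([0, ∞), μ i)`, which carries `A` (with its
domain) to multiplication by `t` (with its maximal domain). -/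
structure SpectralFourierTransform {H : Type u} [NormedAddCommGroup H] [InnerProductSpace ℂ H]
    (A : H →ₗ.[ℂ] H) where
  ι : Type u
  μ : ι → Measure ℝ≥0
  isFinite : ∀ i, IsFiniteMeasure (μ i)
  transform : H ≃ₗᵢ[ℂ] lp (fun i => Lp ℂ 2 (μ i)) 2
  /-- `f` lies in the domain of `A` iff `t ↦ t * (transform f)(t)` is square-integrable. -/
  mem_domain_iff : ∀ f : H, f ∈ A.domain ↔
    ∃ b : lp (fun i => Lp ℂ 2 (μ i)) 2, ∀ i, b i =ᵐ[μ i] fun t => (t : ℂ) * transform f i t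
  transform_apply : ∀ (f : A.domain) (i : ι),
    transform (A f) i =ᵐ[μ i] fun t => (t : ℂ) * transform (f : H) i t

/-- The vectors whose spectral Fourier transform is supported in `[0, ω]`. -/
def SpectralFourierTransform.bandlimited {H : Type u} [NormedAddCommGroup H]
    [InnerProductSpace ℂ H] {A : H →ₗ.[ℂ] H} (F : SpectralFourierTransform A) (ω : ℝ) :
    Submodule ℂ H where
  carrier := {f | ∀ i, ∀ᵐ t : ℝ≥0 ∂(F.μ i), ω < t → F.transform f i t = 0}
  add_mem' := fun {f g} hf hg i => by
    rw [map_add, lp.coeFn_add, Pi.add_apply]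
    filter_upwards [hf i, hg i, Lp.coeFn_add (F.transform f i) (F.transform g i)] with t h1 h2 h3 ht
    rw [h3, Pi.add_apply, h1 ht, h2 ht, add_zero]
  zero_mem' := fun i => by
    rw [map_zero, lp.coeFn_zero, Pi.zero_apply]
    filter_upwards [Lp.coeFn_zero ℂ 2 (F.μ i)] with t h _
    rw [h, Pi.zero_apply]
  smul_mem' := fun c f hf i => by
    rw [map_smul, lp.coeFn_smul, Pi.smul_apply]
    filter_upwards [hf i, Lp.coeFn_smul c (F.transform f i)] with t h1 h2 ht
    rw [h2, Pi.smul_apply, h1 ht, smul_zero]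

section Existence

theorem exists_mulOp {X : Type*} [MeasurableSpace X] (μ : Measure X) (κ : X → ℂ)
    (hκ : Measurable κ) (C : ℝ) (hC : ∀ t, ‖κ t‖ ≤ C) :
    ∃ M : Lp ℂ 2 μ →L[ℂ] Lp ℂ 2 μ, ∀ a, M a =ᵐ[μ] fun t => κ t * a t := by
  let k : Lp ℂ ∞ μ := (memLp_top_of_bound hκ.aestronglyMeasurable C (ae_of_all _ hC)).toLp κ
  have hk : k =ᵐ[μ] κ := MemLp.coeFn_toLp _
  refine ⟨LinearMap.mkContinuous
    { toFun := fun a => (k • a : Lp ℂ 2 μ)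
      map_add' := fun a b => Lp.add_smul k a b
      map_smul' := fun c a => (Lp.smul_comm c k a).symm } ‖k‖
    (fun a => Lp.norm_smul_le k a), fun a => ?_⟩
  have h := Lp.coeFn_lpSMul (r := 2) k a
  filter_upwards [h, hk] with t h1 h2
  rw [← h2]
  exact h1

variable {H : Type u} [NormedAddCommGroup H] [InnerProductSpace ℂ H] [CompleteSpace H]

/-- The cyclic representation attached to a vector and a functional calculus. -/
theorem exists_cyclic {X : Type*} [TopologicalSpace X] [CompactSpace X] [T2Space X]
    [MeasurableSpace X] [BorelSpace X] [NormalSpace X]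
    (Φ : C(X, ℂ) →⋆ₐ[ℂ] (H →L[ℂ] H)) (x : H) :
    ∃ μ : Measure X, IsFiniteMeasure μ ∧ ∃ V : Lp ℂ 2 μ →ₗᵢ[ℂ] H,
      (∀ g : C(X, ℂ), ∀ a : Lp ℂ 2 μ, a =ᵐ[μ] g → V a = Φ g x) ∧
      (∀ (h : C(X, ℂ)) (a b : Lp ℂ 2 μ), (b =ᵐ[μ] fun t => h t * a t) → V b = Φ h (V a)) ∧
      (∀ a, V a ∈ closure (Set.range fun g => Φ g x)) := by
  have hinner : ∀ g h : C(X, ℂ), ⟪Φ g x, Φ h x⟫_ℂ = ⟪x, Φ (star g * h) x⟫_ℂ := by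
    intro g h
    rw [map_mul, map_star, ContinuousLinearMap.star_eq_adjoint, mul_apply_eq_comp,
      ContinuousLinearMap.adjoint_inner_right]
  let ofR : C(X, ℝ) → C(X, ℂ) := fun φ => ⟨fun t => (φ t : ℂ), by fun_prop⟩
  let Λ : CompactlySupportedContinuousMap X ℝ →ₚ[ℝ] ℝ := PositiveLinearMap.mk₀
    { toFun := fun φ => (⟪x, Φ (ofR φ.toContinuousMap) x⟫_ℂ).re
      map_add' := fun φ ψ => by
        have : ofR (φ + ψ).toContinuousMap = ofR φ.toContinuousMap + ofR ψ.toContinuousMap := by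
          ext t; simp [ofR]
        rw [this, map_add, add_apply, inner_add_right, Complex.add_re]
      map_smul' := fun c φ => by
        have : ofR (c • φ).toContinuousMap = (c : ℂ) • ofR φ.toContinuousMap := by
          ext t; simp [ofR]
        rw [this, map_smul, smul_apply, inner_smul_right]
        simp }
    (by
      intro φ hφ
      let ψ : C(X, ℂ) := ⟨fun t => (Real.sqrt (φ t) : ℂ), by fun_prop⟩
      have : ofR φ.toContinuousMap = star ψ * ψ := by
        ext t
        have ht : 0 ≤ φ t := hφ t
        simp only [ofR, ψ, ContinuousMap.coe_mk, ContinuousMap.mul_apply, ContinuousMap.star_apply,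
          Complex.star_def, Complex.conj_ofReal, ← Complex.ofReal_mul, Real.mul_self_sqrt ht]
        rfl
      simp only [LinearMap.coe_mk, AddHom.coe_mk]
      rw [this, ← hinner]
      exact inner_self_nonneg (𝕜 := ℂ))
  let μ := RealRMK.rieszMeasure Λ
  have hμ : ∀ φ : C(X, ℝ), ∫ t, φ t ∂μ = (⟪x, Φ (ofR φ) x⟫_ℂ).re := fun φ =>
    RealRMK.integral_rieszMeasure Λ ⟨φ, HasCompactSupport.of_compactSpace _⟩
  have : IsFiniteMeasure μ := inferInstance
  let e : C(X, ℂ) →ₗ[ℂ] Lp ℂ 2 μ := (ContinuousMap.toLp (E := ℂ) 2 μ ℂ).toLinearMap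
  have he : ∀ g, e g =ᵐ[μ] g := fun g => ContinuousMap.coeFn_toLp μ g
  have hd : DenseRange e := ContinuousMap.toLp_denseRange ℂ μ ℂ (by norm_num)
  let f : C(X, ℂ) →ₗ[ℂ] H :=
    { toFun := fun g => Φ g x
      map_add' := fun g h => by rw [map_add, add_apply]
      map_smul' := fun c g => by rw [map_smul]; rfl }
  have hnorm : ∀ g, ‖f g‖ = ‖e g‖ := by
    intro g
    have h1 : ‖f g‖ ^ 2 = ∫ t, ‖g t‖ ^ 2 ∂μ := by
      have := hμ ⟨fun t => ‖g t‖ ^ 2, by fun_prop⟩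
      simp only [ContinuousMap.coe_mk] at this
      rw [this]
      have h2 : ofR ⟨fun t => ‖g t‖ ^ 2, by fun_prop⟩ = star g * g := by
        ext t
        simp [ofR, ← Complex.normSq_eq_conj_mul_self, Complex.normSq_eq_norm_sq]
      rw [h2, ← hinner]
      exact (inner_self_eq_norm_sq (𝕜 := ℂ) (f g)).symm
    have h3 : ‖e g‖ ^ 2 = ∫ t, ‖g t‖ ^ 2 ∂μ := by
      have h4 := inner_self_eq_norm_sq (𝕜 := ℂ) (e g)
      rw [← h4, L2.inner_def, ← integral_re]
      · refine integral_congr_ae ?_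
        filter_upwards [he g] with t ht
        rw [ht]
        exact inner_self_eq_norm_sq (𝕜 := ℂ) (g t)
      · exact L2.integrable_inner _ _
    exact (pow_left_inj₀ (norm_nonneg _) (norm_nonneg _) two_ne_zero).1 (h1.trans h3.symm)
  let V₀ := f.extendOfNorm e
  have hV₀ : ∀ g, V₀ (e g) = Φ g x := fun g =>
    LinearMap.extendOfNorm_eq hd ⟨1, fun g => by rw [one_mul, hnorm]⟩ g
  let V : Lp ℂ 2 μ →ₗᵢ[ℂ] H :=
    { V₀.toLinearMap with
      norm_map' := fun a => by
        refine hd.induction_on (p := fun a => ‖V₀ a‖ = ‖a‖) a ?_ ?_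
        · exact isClosed_eq (by fun_prop) (by fun_prop)
        · intro g
          rw [hV₀, ← hnorm]
          rfl }
  have hV : ∀ a, V a = V₀ a := fun _ => rfl
  refine ⟨μ, inferInstance, V, ?_, ?_, ?_⟩
  · intro g a hag
    have : a = e g := Lp.ext (hag.trans (he g).symm)
    rw [hV, this, hV₀]
  · intro h a b hb
    obtain ⟨C, hC⟩ : ∃ C, ∀ t, ‖h t‖ ≤ C := ⟨‖h‖, h.norm_coe_le_norm⟩
    obtain ⟨M, hM⟩ := exists_mulOp μ h h.continuous.measurable C hC
    have hbM : b = M a := Lp.ext (hb.trans (hM a).symm)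
    rw [hbM, hV, hV]
    refine hd.induction_on (p := fun a => V₀ (M a) = Φ h (V₀ a)) a ?_ ?_
    · exact isClosed_eq (by fun_prop) (by fun_prop)
    · intro g
      have : M (e g) = e (h * g) := by
        refine Lp.ext ?_
        filter_upwards [hM (e g), he g, he (h * g)] with t h1 h2 h3
        rw [h1, h2, h3]
        rfl
      rw [this, hV₀, hV₀, map_mul, mul_apply_eq_comp]
  · intro a
    rw [hV]
    refine hd.induction_on (p := fun a => V₀ a ∈ closure (Set.range fun g => Φ g x)) a ?_ ?_
    · exact isClosed_closure.preimage V₀.continuous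
    · intro g
      rw [hV₀]
      exact subset_closure ⟨g, rfl⟩

open scoped ComplexOrder in
/-- The cyclic representation of a positive injective contraction `T`, in the variable
`t = T⁻¹ - 1`. -/
theorem exists_cyclic_resolvent (T : H →L[ℂ] H) (hT : T.IsPositive) (hT1 : ‖T‖ ≤ 1)
    (hinj : ∀ f, T f = 0 → f = 0) :
    ∃ Φ : C(spectrum ℂ T, ℂ) →⋆ₐ[ℂ] (H →L[ℂ] H), ∀ x : H,
      ∃ ν : Measure ℝ≥0, IsFiniteMeasure ν ∧ ∃ W : Lp ℂ 2 ν →ₗᵢ[ℂ] H,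
      (∀ a b : Lp ℂ 2 ν, (b =ᵐ[ν] fun t => (1 + (t : ℂ))⁻¹ * a t) → W b = T (W a)) ∧
      (∀ g, Φ g x ∈ Set.range W) ∧
      (∀ a, W a ∈ closure (Set.range fun g => Φ g x)) := by
  have hsa : IsSelfAdjoint T := hT.isSelfAdjoint
  have hnormal : IsStarNormal T := hsa.isStarNormal
  refine ⟨cfcHom hnormal, fun x => ?_⟩
  obtain ⟨μ, hμ, V, hV1, hV2, hV3⟩ := exists_cyclic (cfcHom hnormal) x
  let idX : C(spectrum ℂ T, ℂ) := (ContinuousMap.id ℂ).restrict (spectrum ℂ T)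
  have hid : cfcHom hnormal idX = T := cfcHom_id hnormal
  have hspec : ∀ z ∈ spectrum ℂ T, ∃ r : ℝ, 0 ≤ r ∧ r ≤ 1 ∧ z = r := by
    intro z hz
    have h1 : 0 ≤ z := spectrum_nonneg_of_nonneg
      ((ContinuousLinearMap.nonneg_iff_isPositive T).2 hT) hz
    have h2 : ‖z‖ ≤ 1 := by
      refine (spectrum.norm_le_norm_mul_of_mem hz).trans ?_
      exact mul_le_one₀ hT1 (norm_nonneg _) ContinuousLinearMap.norm_id_le
    rw [Complex.nonneg_iff] at h1
    have h3 : z = (z.re : ℂ) := Complex.ext rfl (by simp [← h1.2])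
    refine ⟨z.re, h1.1, ?_, h3⟩
    exact (Complex.re_le_norm z).trans h2
  have hzero : ∀ᵐ z : spectrum ℂ T ∂μ, (z : ℂ) ≠ 0 := by
    have hms : MeasurableSet {z : spectrum ℂ T | (z : ℂ) = 0} :=
      measurableSet_eq_fun measurable_subtype_coe measurable_const
    let a : Lp ℂ 2 μ := indicatorConstLp 2 hms (measure_ne_top _ _) 1
    have ha : a =ᵐ[μ] Set.indicator {z : spectrum ℂ T | (z : ℂ) = 0} fun _ => (1 : ℂ) :=
      indicatorConstLp_coeFn
    have h0 : V 0 = cfcHom hnormal idX (V a) := by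
      refine hV2 idX a 0 ?_
      filter_upwards [ha, Lp.coeFn_zero ℂ 2 μ] with z hz h0
      rw [hz, h0]
      by_cases h : (z : ℂ) = 0
      · simp [idX, h]
      · simp [h]
    rw [map_zero, hid] at h0
    have ha0 : a = 0 := V.injective ((hinj _ h0.symm).trans (map_zero V).symm)
    rw [ha0] at ha
    filter_upwards [ha, Lp.coeFn_zero ℂ 2 μ] with z hz h0 h
    rw [h0] at hz
    simp [h] at hz
  let lam : spectrum ℂ T → ℝ≥0 := fun z => ((z : ℂ).re⁻¹ - 1).toNNReal
  have hlam : Measurable lam := by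
    have : Measurable fun z : spectrum ℂ T => (z : ℂ).re :=
      Complex.measurable_re.comp measurable_subtype_coe
    exact (this.inv.sub_const 1).real_toNNReal
  have hlam' : ∀ z : spectrum ℂ T, (z : ℂ) ≠ 0 → (1 + ((lam z : ℝ≥0) : ℂ))⁻¹ = z := by
    intro z hz
    obtain ⟨r, h0, h1, hr⟩ := hspec z z.2
    have hr0 : r ≠ 0 := by rintro rfl; exact hz (by simpa using hr)
    have hpos : 0 < r := lt_of_le_of_ne h0 hr0.symm
    have : ((lam z : ℝ≥0) : ℝ) = r⁻¹ - 1 := by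
      simp only [lam, hr, Complex.ofReal_re]
      exact Real.coe_toNNReal _ (sub_nonneg.2 ((one_le_inv₀ hpos).2 h1))
    have h2 : ((lam z : ℝ≥0) : ℂ) = (r : ℂ)⁻¹ - 1 := by
      have := congrArg (fun s : ℝ => (s : ℂ)) this
      simpa using this
    rw [h2, hr]
    simp
  let ν := μ.map lam
  have hmp : MeasurePreserving lam μ ν := ⟨hlam, rfl⟩
  let J : Lp ℂ 2 ν →ₗᵢ[ℂ] Lp ℂ 2 μ := Lp.compMeasurePreservingₗᵢ ℂ lam hmp
  have hJ : ∀ a, J a =ᵐ[μ] a ∘ lam := fun a => Lp.coeFn_compMeasurePreserving a hmp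
  refine ⟨ν, Measure.isFiniteMeasure_map μ lam, V.comp J, ?_, ?_, fun a => hV3 _⟩
  · intro a b hb
    have : V (J b) = cfcHom hnormal idX (V (J a)) := by
      refine hV2 idX _ _ ?_
      filter_upwards [hJ a, hJ b, hmp.quasiMeasurePreserving.ae hb, hzero] with z h1 h2 h3 h4
      rw [h2, h1, Function.comp_apply, h3, hlam' z h4]
      rfl
    rw [hid] at this
    exact this
  · intro g
    have hcl : MeasurableSet (spectrum ℂ T) := (spectrum.isClosed T).measurableSet
    obtain ⟨g', hg', hgg⟩ := (MeasurableEmbedding.subtype_coe hcl).exists_measurable_extend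
      g.continuous.measurable (fun _ => ⟨(0 : ℂ)⟩)
    let q : ℝ≥0 → ℂ := fun t => g' (1 + (t : ℂ))⁻¹
    have hq : Measurable q := by
      refine hg'.comp ?_
      have : Measurable fun t : ℝ≥0 => (t : ℂ) :=
        Complex.measurable_ofReal.comp measurable_coe_nnreal_real
      exact (this.const_add 1).inv
    have hql : ∀ᵐ z ∂μ, q (lam z) = g z := by
      filter_upwards [hzero] with z hz
      simp only [q]
      rw [hlam' z hz]
      exact congrFun hgg z
    have hqmem : MemLp q 2 ν := by
      rw [memLp_map_measure_iff hq.aestronglyMeasurable hlam.aemeasurable]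
      have hg2 : MemLp g 2 μ :=
        (Lp.memLp (ContinuousMap.toLp (E := ℂ) 2 μ ℂ g)).ae_eq (ContinuousMap.coeFn_toLp μ g)
      exact hg2.ae_eq (hql.mono fun z hz => hz.symm)
    refine ⟨hqmem.toLp q, ?_⟩
    refine hV1 g _ ?_
    filter_upwards [hJ (hqmem.toLp q), hmp.quasiMeasurePreserving.ae hqmem.coeFn_toLp, hql]
      with z h1 h2 h3
    exact h1.trans (h2.trans h3)

/-- The spectral theorem for a nonnegative self-adjoint operator `A` with `T = (1 + A)⁻¹`. -/
theorem nonempty_spectralFourierTransform (A : H →ₗ.[ℂ] H) (T : H →L[ℂ] H)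
    (hT : T.IsPositive) (hT1 : ‖T‖ ≤ 1) (hdom : ∀ f, T f ∈ A.domain)
    (hright : ∀ f, T f + A ⟨T f, hdom f⟩ = f)
    (hleft : ∀ f : A.domain, T ((f : H) + A f) = f) :
    Nonempty (SpectralFourierTransform A) := by
  classical
  have hinj : ∀ f, T f = 0 → f = 0 := by
    intro f hf
    rw [← hright f]
    have : (⟨T f, hdom f⟩ : A.domain) = 0 := Subtype.ext hf
    rw [this, hf, LinearPMap.map_zero, add_zero]
  obtain ⟨Φ, hΦ⟩ := exists_cyclic_resolvent T hT hT1 hinj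
  choose ν hν W hW1 hW2 hW3 using hΦ
  have hadj : ∀ (g : C(spectrum ℂ T, ℂ)) x y, ⟪Φ g x, y⟫_ℂ = ⟪x, Φ (star g) y⟫_ℂ := by
    intro g x y
    rw [map_star, ContinuousLinearMap.star_eq_adjoint, ContinuousLinearMap.adjoint_inner_right]
  obtain ⟨s, hs⟩ := zorn_subset
    {s : Set H | ∀ x ∈ s, ∀ y ∈ s, x ≠ y → ∀ g, ⟪x, Φ g y⟫_ℂ = 0} (by
      intro c hc hchain
      refine ⟨⋃₀ c, ?_, fun s hs => Set.subset_sUnion_of_mem hs⟩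
      rintro x ⟨a, ha, hxa⟩ y ⟨b, hb, hyb⟩ hxy g
      rcases hchain.total ha hb with h | h
      · exact hc hb x (h hxa) y hyb hxy g
      · exact hc ha x hxa y (h hyb) hxy g)
  have horth : OrthogonalFamily ℂ (fun i : s => Lp ℂ 2 (ν i)) (fun i => W i) := by
    intro i j hij a b
    have hij' : (i : H) ≠ j := fun h => hij (Subtype.ext h)
    have hdense : ∀ p ∈ closure (Set.range fun g => Φ g (i : H)),
        ∀ q ∈ closure (Set.range fun g => Φ g (j : H)), ⟪p, q⟫_ℂ = 0 := by
      intro p hp q hq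
      refine closure_minimal (s := Set.range fun g => Φ g (i : H))
        (t := {p | ⟪p, q⟫_ℂ = 0}) ?_ (isClosed_eq (by fun_prop) (by fun_prop)) hp
      rintro _ ⟨g, rfl⟩
      refine closure_minimal (s := Set.range fun g => Φ g (j : H))
        (t := {q | ⟪Φ g (i : H), q⟫_ℂ = 0}) ?_ (isClosed_eq (by fun_prop) (by fun_prop)) hq
      rintro _ ⟨h, rfl⟩
      change ⟪Φ g (i : H), Φ h (j : H)⟫_ℂ = 0
      rw [hadj, ← mul_apply_eq_comp, ← map_mul]
      exact hs.prop i i.2 j j.2 hij' _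
    exact hdense _ (hW3 i a) _ (hW3 j b)
  have htotal : ⊤ ≤ (⨆ i : s, LinearMap.range (W i).toLinearMap).topologicalClosure := by
    rw [top_le_iff, Submodule.topologicalClosure_eq_top_iff, Submodule.eq_bot_iff]
    intro z hz
    have hz' : ∀ x ∈ s, ∀ g, ⟪Φ g x, z⟫_ℂ = 0 := by
      intro x hx g
      obtain ⟨a, ha⟩ := hW2 x g
      refine (Submodule.mem_orthogonal _ _).1 hz _ ?_
      refine Submodule.mem_iSup_of_mem (⟨x, hx⟩ : s) ?_
      exact ⟨a, ha⟩
    have hzs : z ∈ s := by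
      refine hs.le_of_ge (y := insert z s) ?_ (Set.subset_insert z s) (Set.mem_insert z s)
      rintro x hx y hy hxy g
      rcases hx with rfl | hx <;> rcases hy with rfl | hy
      · exact absurd rfl hxy
      · rw [← inner_conj_symm, hz' y hy g, map_zero]
      · have := hz' x hx (star g)
        rwa [hadj, star_star] at this
      · exact hs.prop x hx y hy hxy g
    have := hz' z hzs 1
    rw [map_one] at this
    exact inner_self_eq_zero.1 this
  have hsum : IsHilbertSum ℂ (fun i : s => Lp ℂ 2 (ν i)) (fun i => W i) :=
    IsHilbertSum.mk horth htotal
  let U := hsum.linearIsometryEquiv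
  have hUinner : ∀ (i : s) (a : Lp ℂ 2 (ν i)) (f : H), ⟪W i a, f⟫_ℂ = ⟪a, U f i⟫_ℂ := by
    intro i a f
    have h1 := lp.inner_single_left (𝕜 := ℂ) i a (U f)
    have h2 : U.symm (lp.single 2 i a) = W i a := hsum.linearIsometryEquiv_symm_apply_single a
    have h3 := U.inner_map_map (U.symm (lp.single 2 i a)) f
    rw [LinearIsometryEquiv.apply_symm_apply, h2] at h3
    exact h3.symm.trans h1
  have hpos : ∀ t : ℝ≥0, (1 + (t : ℂ)) ≠ 0 := by
    intro t h
    have h1 := congrArg Complex.re h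
    have h2 := t.2
    simp at h1
    linarith [t.coe_nonneg]
  have hUT : ∀ f (i : s), U (T f) i =ᵐ[ν i] fun t => (1 + (t : ℂ))⁻¹ * U f i t := by
    intro f i
    obtain ⟨M, hM⟩ := exists_mulOp (ν i) (fun t : ℝ≥0 => (1 + (t : ℂ))⁻¹)
      ((Complex.measurable_ofReal.comp measurable_coe_nnreal_real).const_add 1).inv 1 (by
        intro t
        have h1 : ‖(1 + (t : ℂ))‖ = 1 + t := by
          have : (1 + (t : ℂ)) = ((1 + (t : ℝ) : ℝ) : ℂ) := by push_cast; rfl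
          rw [this, Complex.norm_real, Real.norm_of_nonneg (by positivity)]
        rw [norm_inv, h1]
        exact inv_le_one_of_one_le₀ (by linarith [t.coe_nonneg]))
    have key : U (T f) i = M (U f i) := by
      refine ext_inner_left ℂ fun a => ?_
      rw [← hUinner]
      have h1 : ⟪W i a, T f⟫_ℂ = ⟪W i (M a), f⟫_ℂ := by
        rw [hW1 i a (M a) (hM a)]
        exact (hT.isSelfAdjoint.isSymmetric (W i a) f).symm
      rw [h1, hUinner, L2.inner_def, L2.inner_def]
      refine integral_congr_ae ?_
      filter_upwards [hM a, hM (U f i)] with t h2 h3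
      rw [h2, h3]
      simp only [RCLike.inner_apply, map_mul]
      have : conj ((1 + (t : ℂ))⁻¹) = (1 + (t : ℂ))⁻¹ := by simp
      rw [this]
      ring
    rw [key]
    exact hM _
  have hUA : ∀ (f : A.domain) (i : s), U (A f) i =ᵐ[ν i] fun t => (t : ℂ) * U (f : H) i t := by
    intro f i
    have h1 := hUT ((f : H) + A f) i
    rw [hleft f, map_add, lp.coeFn_add, Pi.add_apply] at h1
    filter_upwards [h1, Lp.coeFn_add (U (f : H) i) (U (A f) i)] with t h2 h3
    rw [h3, Pi.add_apply] at h2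
    have := hpos t
    field_simp at h2
    linear_combination -h2
  refine ⟨⟨s, fun i => ν i, fun i => hν i, U, fun f => ⟨fun hf => ?_, ?_⟩, hUA⟩⟩
  · exact ⟨U (A ⟨f, hf⟩), hUA ⟨f, hf⟩⟩
  · rintro ⟨b, hb⟩
    have : T (U.symm (U f + b)) = f := by
      apply U.injective
      refine lp.ext (funext fun i => Lp.ext ?_)
      have h1 := hUT (U.symm (U f + b)) i
      rw [LinearIsometryEquiv.apply_symm_apply, lp.coeFn_add, Pi.add_apply] at h1
      filter_upwards [h1, Lp.coeFn_add (U f i) (b i), hb i] with t h2 h3 h4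
      rw [h2, h3, Pi.add_apply, h4]
      have := hpos t
      field_simp
    rw [← this]
    exact hdom _

end Existence
/-- Bernstein inequality. -/
theorem SpectralFourierTransform.bernstein {H : Type u} [NormedAddCommGroup H]
    [InnerProductSpace ℂ H] {A : H →ₗ.[ℂ] H} (F : SpectralFourierTransform A) {ω : ℝ}
    (hω : 0 ≤ ω) {f : H} (hf : f ∈ F.bandlimited ω) :
    ∃ h : f ∈ A.domain, A ⟨f, h⟩ ∈ F.bandlimited ω ∧ ‖A ⟨f, h⟩‖ ≤ ω * ‖f‖ := by
  have hmem : ∀ i, MemLp (fun t : ℝ≥0 => (t : ℂ) * F.transform f i t) 2 (F.μ i) := by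
    intro i
    refine MemLp.of_le_mul (c := ω) (Lp.memLp (F.transform f i)) ?_ ?_
    · exact (Complex.measurable_ofReal.comp measurable_coe_nnreal_real).aestronglyMeasurable.mul
        (Lp.aestronglyMeasurable _)
    · filter_upwards [hf i] with t ht
      by_cases h : ω < t
      · rw [ht h]; simp
      · rw [norm_mul, Complex.norm_real, Real.norm_of_nonneg t.coe_nonneg]
        exact mul_le_mul_of_nonneg_right (not_lt.1 h) (norm_nonneg _)
  have hle : ∀ i, ‖(hmem i).toLp _‖ ≤ ω * ‖F.transform f i‖ := by
    intro i
    refine Lp.norm_le_mul_norm_of_ae_le_mul ?_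
    filter_upwards [hf i, (hmem i).coeFn_toLp] with t ht h2
    rw [h2]
    by_cases h : ω < t
    · rw [ht h]; simp
    · rw [norm_mul, Complex.norm_real, Real.norm_of_nonneg t.coe_nonneg]
      exact mul_le_mul_of_nonneg_right (not_lt.1 h) (norm_nonneg _)
  have hle2 : ∀ i, ‖(hmem i).toLp _‖ ≤ ‖((ω : ℂ) • F.transform f) i‖ := by
    intro i
    rw [lp.coeFn_smul, Pi.smul_apply, norm_smul, Complex.norm_real, Real.norm_of_nonneg hω]
    exact hle i
  let b : lp (fun i => Lp ℂ 2 (F.μ i)) 2 :=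
    ⟨fun i => (hmem i).toLp _, (lp.memℓp ((ω : ℂ) • F.transform f)).mono' hle2⟩
  have hb : ∀ i, b i =ᵐ[F.μ i] fun t => (t : ℂ) * F.transform f i t :=
    fun i => (hmem i).coeFn_toLp
  have hdom : f ∈ A.domain := (F.mem_domain_iff f).2 ⟨b, hb⟩
  refine ⟨hdom, fun i => ?_, ?_⟩
  · filter_upwards [hf i, F.transform_apply ⟨f, hdom⟩ i] with t h1 h2 ht
    rw [h2, h1 ht, mul_zero]
  · have hAb : F.transform (A ⟨f, hdom⟩) = b :=
      lp.ext (funext fun i => Lp.ext ((F.transform_apply ⟨f, hdom⟩ i).trans (hb i).symm))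
    rw [← F.transform.norm_map, hAb, ← F.transform.norm_map f]
    have h1 : ‖b‖ ≤ ‖(ω : ℂ) • F.transform f‖ := lp.norm_mono (by norm_num) hle2
    rwa [norm_smul, Complex.norm_real, Real.norm_of_nonneg hω] at h1

/-- The space of vectors band-limited to `[0, ω]` does not depend on the transform. -/
theorem SpectralFourierTransform.bandlimited_le {H : Type u} [NormedAddCommGroup H]
    [InnerProductSpace ℂ H] {A : H →ₗ.[ℂ] H} (F F' : SpectralFourierTransform A) (ω : ℝ) :
    F.bandlimited ω ≤ F'.bandlimited ω := by
  intro f hf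
  rcases lt_or_ge ω 0 with hω | hω
  · have h0 : F.transform f = 0 := by
      refine lp.ext (funext fun i => Lp.ext ?_)
      filter_upwards [hf i, Lp.coeFn_zero ℂ 2 (F.μ i)] with t h1 h2
      rw [h1 (hω.trans_le t.coe_nonneg)]
      exact h2.symm
    have : f = 0 := F.transform.injective (h0.trans (map_zero F.transform).symm)
    rw [this]
    exact zero_mem _
  · have hseq : ∀ n : ℕ, ∃ g ∈ F.bandlimited ω, ‖g‖ ≤ ω ^ n * ‖f‖ ∧
        ∀ i, F'.transform g i =ᵐ[F'.μ i] fun t => (t : ℂ) ^ n * F'.transform f i t := by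
      intro n
      induction n with
      | zero => exact ⟨f, hf, by simp, fun i => by simp⟩
      | succ n ih =>
        obtain ⟨g, hg, hgn, hgi⟩ := ih
        obtain ⟨hd, h1, h2⟩ := F.bernstein hω hg
        refine ⟨_, h1, h2.trans ?_, fun i => ?_⟩
        · rw [pow_succ', mul_assoc]
          exact mul_le_mul_of_nonneg_left hgn hω
        · filter_upwards [F'.transform_apply ⟨g, hd⟩ i, hgi i] with t h3 h4
          rw [h3, h4, pow_succ', mul_assoc]
    intro i
    have hc : ∀ k : ℕ, ∀ᵐ t : ℝ≥0 ∂(F'.μ i), ω + 1 / (k + 1) ≤ t → F'.transform f i t = 0 := by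
      intro k
      set c : ℝ := ω + 1 / (k + 1)
      have hcω : ω < c := lt_add_of_pos_right _ Nat.one_div_pos_of_nat
      have hc0 : 0 < c := hω.trans_lt hcω
      have hS : MeasurableSet {t : ℝ≥0 | c ≤ t} :=
        measurableSet_le measurable_const measurable_coe_nnreal_real
      have hmem : MemLp ({t : ℝ≥0 | c ≤ t}.indicator (F'.transform f i)) 2 (F'.μ i) :=
        (Lp.memLp _).indicator hS
      have hbound : ∀ n : ℕ, ‖hmem.toLp _‖ ≤ (ω / c) ^ n * ‖f‖ := by
        intro n
        obtain ⟨g, _, hgn, hgi⟩ := hseq n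
        have h1 : ‖hmem.toLp _‖ ≤ (c ^ n)⁻¹ * ‖F'.transform g i‖ := by
          refine Lp.norm_le_mul_norm_of_ae_le_mul ?_
          filter_upwards [hmem.coeFn_toLp, hgi i] with t h2 h3
          rw [h2, h3]
          by_cases ht : c ≤ t
          · rw [Set.indicator_of_mem (by exact ht), norm_mul, norm_pow, Complex.norm_real,
              Real.norm_of_nonneg t.coe_nonneg, ← mul_assoc]
            refine le_mul_of_one_le_left (norm_nonneg _) ?_
            rw [inv_mul_eq_div, one_le_div (by positivity)]
            exact pow_le_pow_left₀ hc0.le ht n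
          · rw [Set.indicator_of_notMem (by exact ht), norm_zero]
            positivity
        refine h1.trans ?_
        have h2 : ‖F'.transform g i‖ ≤ ω ^ n * ‖f‖ :=
          (lp.norm_apply_le_norm (by norm_num) _ i).trans
            ((F'.transform.norm_map g).le.trans hgn)
        rw [div_pow, div_eq_inv_mul, mul_assoc]
        exact mul_le_mul_of_nonneg_left h2 (by positivity)
      have hlim : Tendsto (fun n : ℕ => (ω / c) ^ n * ‖f‖) atTop (𝓝 (0 * ‖f‖)) :=
        (tendsto_pow_atTop_nhds_zero_of_lt_one (by positivity)
          ((div_lt_one hc0).2 hcω)).mul_const _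
      rw [zero_mul] at hlim
      have h0 : hmem.toLp _ = 0 :=
        norm_le_zero_iff.1 (ge_of_tendsto' hlim hbound)
      have h1 := hmem.coeFn_toLp
      rw [h0] at h1
      filter_upwards [h1, Lp.coeFn_zero ℂ 2 (F'.μ i)] with t h2 h3 ht
      rw [h3, Set.indicator_of_mem (by exact ht)] at h2
      exact h2.symm
    filter_upwards [ae_all_iff.2 hc] with t ht hωt
    obtain ⟨k, hk⟩ := exists_nat_one_div_lt (sub_pos.2 hωt)
    exact ht k (by linarith)

section PaleyWiener

variable {V : Type u} (G : SimpleGraph V) [G.LocallyFinite]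

theorem exists_spectralFourierTransform_laplacian :
    Nonempty (SpectralFourierTransform (laplacian G)) :=
  nonempty_spectralFourierTransform (laplacian G) (resolvent G) (resolvent_isPositive G)
    (norm_resolvent_le G) (resolvent_mem_domain G) (resolvent_right G) (resolvent_left G)

/-- The spectral Fourier transform of the Laplacian. -/
noncomputable def spectralFourierTransform : SpectralFourierTransform (laplacian G) :=
  (exists_spectralFourierTransform_laplacian G).some

/-- The Paley-Wiener space `PW_ω(L)`: the functions whose spectral Fourier transform is
supported in `[0, ω]`. -/
noncomputable def paleyWiener (ω : ℝ) : Submodule ℂ (L2 V) :=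
  (spectralFourierTransform G).bandlimited ω

/-- `PW_ω(L)` may be computed with any spectral Fourier transform of `L`. -/
theorem paleyWiener_eq (F : SpectralFourierTransform (laplacian G)) (ω : ℝ) :
    paleyWiener G ω = F.bandlimited ω :=
  le_antisymm (SpectralFourierTransform.bandlimited_le _ _ ω)
    (SpectralFourierTransform.bandlimited_le _ _ ω)

/-- The vertex boundary `bS`: vertices outside `S` adjacent to a vertex of `S`. -/
def vertexBoundary {V : Type u} (G : SimpleGraph V) (S : Set V) : Set V :=
  {v | v ∉ S ∧ ∃ w ∈ S, G.Adj w v}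

/-- `S` is a uniqueness set for a space `M` of functions: functions in `M` that agree on `S`
are equal. -/
def IsUniquenessSet {V : Type u} (S : Set V) (M : Submodule ℂ (L2 V)) : Prop :=
  ∀ f ∈ M, ∀ g ∈ M, (∀ w ∈ S, f w = g w) → f = g

end PaleyWiener

end GraphSampling

/-! Let every vertex v outside S select a set n(v) of exactly K₀ neighbours in S. The selected edges
vu are distinct, so the sum of |f(v) − f(u)|² over them is at most the energy ⟨f, Lf⟩
(`sum_norm_sub_sq_le_laplacian`), and Bernstein's inequality bounds the energy by max(ω, 0)‖f‖² when
f lies in PW_ω. Summing |f(v)|² ≤ 2|f(v) − f(u)|² + 2|f(u)|² over the selected edges gives K₀ Σ_{v ∉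
S} |f(v)|² ≤ 2 max(ω, 0)‖f‖² + 2 Σ_{u ∈ S} w(u)|f(u)|², where w(u) is the number of vertices that
select u (`sum_card_mul_norm_sq_le`). Since ω < K₀/4, the first term on the right is at most
K₀‖f‖²/2 and can be absorbed, so the weighted samples control ‖f‖. The same inequality with u and v
exchanged bounds the weighted samples by ‖f‖ (`sum_weight_mul_norm_sq_le`). The constant there does
not involve the degrees, although w itself may be unbounded; this is why the samples carry weights.

Hence f ↦ (√(1 + w(u)) f(u)) is bounded and bounded below from the closed space PW_ω to ℓ²(S). A
bounded left inverse, applied to the coordinate expansion of the samples, gives the series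
(`exists_hasSum_of_weighted_sampling`). Uniqueness follows, because the series sees f only through
its values on S. -/

namespace GraphSampling

/-! ### The Dirichlet energy dominates sums of squared differences over selected edges. -/

section Energy

variable {V : Type*} (G : SimpleGraph V) [G.LocallyFinite]

/-- The energy `⟪f, L f⟫` of a finitely supported function dominates the sum of
`‖f v - f u‖²` over any finite set of edges, each counted with one orientation. -/
theorem sum_norm_sub_sq_le_finLap (n : V → Finset V) (hadj : ∀ v, ∀ u ∈ n v, G.Adj v u)
    (hanti : ∀ v, ∀ u ∈ n v, v ∉ n u) (F : Finset V) (f : V →₀ ℂ) :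
    ∑ v ∈ F, ∑ u ∈ n v, ‖f v - f u‖ ^ 2 ≤ (⟪finIncl V f, finLap G f⟫_ℂ).re := by
  classical
  -- A finite set large enough that both sides become double sums over T × T, which can then be
  -- symmetrized.
  set T : Finset V := F ∪ F.biUnion n ∪ f.support ∪ f.support.biUnion fun v => G.neighborFinset v
  have hFT : F ⊆ T := fun v hv => by simp [T, hv]
  have hnT : ∀ v ∈ F, n v ⊆ T := fun v hv u hu => by
    simp only [T, Finset.mem_union, Finset.mem_biUnion]
    exact Or.inl (Or.inl (Or.inr ⟨v, hv, hu⟩))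
  have hsT : f.support ⊆ T := fun v hv => by
    simp only [T, Finset.mem_union]
    exact Or.inl (Or.inr hv)
  have hNT : ∀ v ∈ f.support, G.neighborFinset v ⊆ T := fun v hv u hu => by
    simp only [T, Finset.mem_union, Finset.mem_biUnion]
    exact Or.inr ⟨v, hv, hu⟩
  have h1 : ⟪finIncl V f, finLap G f⟫_ℂ =
      ∑ v ∈ T, ∑ u ∈ T, if G.Adj v u then conj (f v) * (f v - f u) else 0 := by
    have hf : finIncl V f = ∑ v ∈ f.support, lp.single 2 v (f v) := by
      ext w
      rw [lp.coeFn_sum, Finset.sum_apply, finIncl_apply]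
      simp [Pi.single_apply]
    rw [hf, sum_inner, ← Finset.sum_subset hsT]
    · refine Finset.sum_congr rfl fun v hv => ?_
      rw [lp.inner_single_left, ← Finset.sum_filter]
      have : T.filter (fun u => G.Adj v u) = G.neighborFinset v := by
        ext u
        simp only [Finset.mem_filter, SimpleGraph.mem_neighborFinset, and_iff_right_iff_imp]
        exact fun h => hNT v hv ((G.mem_neighborFinset v u).2 h)
      rw [this, ← Finset.mul_sum]
      simp [lapFun, mul_comm]
    · intro v _ hv
      rw [Finsupp.notMem_support_iff] at hv
      simp [hv]
  set d : V → V → ℝ := fun v u => ‖f v - f u‖ ^ 2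
  have hd : ∀ v u, d v u = d u v := fun v u => by simp only [d, norm_sub_rev]
  set e : V → V → ℝ := fun v u => if G.Adj v u then (conj (f v) * (f v - f u)).re else 0
  set c : V → V → ℝ := fun v u => if v ∈ F ∧ u ∈ n v then d v u else 0
  have h2 : (⟪finIncl V f, finLap G f⟫_ℂ).re = ∑ v ∈ T, ∑ u ∈ T, e v u := by
    rw [h1, Complex.re_sum]
    refine Finset.sum_congr rfl fun v _ => ?_
    rw [Complex.re_sum]
    refine Finset.sum_congr rfl fun u _ => ?_
    simp only [e]
    split_ifs <;> rfl
  have h3 : ∑ v ∈ F, ∑ u ∈ n v, d v u = ∑ v ∈ T, ∑ u ∈ T, c v u := by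
    rw [← Finset.sum_subset hFT]
    · refine Finset.sum_congr rfl fun v hv => ?_
      rw [← Finset.sum_subset (hnT v hv)]
      · exact Finset.sum_congr rfl fun u hu => by simp [c, hv, hu]
      · intro u _ hu
        simp [c, hu]
    · intro v _ hv
      simp [c, hv]
  -- On an edge the two orientations of the energy term add up to |f(v) − f(u)|². By `hanti` at most
  -- one orientation is selected, so the left side is at most this value.
  have hce : ∀ v u, c v u + c u v ≤ e v u + e u v := by
    intro v u
    have hd0 : 0 ≤ d v u := by positivity
    have hsum : (conj (f v) * (f v - f u)).re + (conj (f u) * (f u - f v)).re = d v u := by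
      simp only [d, ← Complex.normSq_eq_norm_sq, Complex.normSq_apply]
      simp
      ring
    by_cases ha : G.Adj v u
    · simp only [e, ha, ha.symm, if_true, hsum, c, hd u v]
      by_cases h : u ∈ n v
      · have := hanti v u h
        simp only [h, this, and_true, and_false, if_false, add_zero]
        split_ifs <;> simp [hd0]
      · simp only [h, and_false, if_false, zero_add]
        split_ifs <;> simp [hd0]
    · have hv : u ∉ n v := fun h => ha (hadj v u h)
      have hu : v ∉ n u := fun h => ha (hadj u v h).symm
      simp [e, c, hv, hu, ha, G.adj_comm u v]
  have h4 : ∑ v ∈ T, ∑ u ∈ T, (c v u + c u v) ≤ ∑ v ∈ T, ∑ u ∈ T, (e v u + e u v) :=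
    Finset.sum_le_sum fun v _ => Finset.sum_le_sum fun u _ => hce v u
  simp only [Finset.sum_add_distrib] at h4
  rw [Finset.sum_comm (f := fun v u => c u v), Finset.sum_comm (f := fun v u => e u v)] at h4
  change ∑ v ∈ F, ∑ u ∈ n v, d v u ≤ _
  rw [h2, h3]
  linarith

theorem continuous_eval (v : V) : Continuous fun f : L2 V => f v :=
  (continuous_apply v).comp (lp.uniformContinuous_coe (p := 2)
    (E := fun _ : V => ℂ)).continuous

/-- The energy estimate on the whole domain of the Laplacian; finitely supported functions
form a core. -/
theorem sum_norm_sub_sq_le_laplacian (n : V → Finset V) (hadj : ∀ v, ∀ u ∈ n v, G.Adj v u)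
    (hanti : ∀ v, ∀ u ∈ n v, v ∉ n u) (F : Finset V) (f : (laplacian G).domain) :
    ∑ v ∈ F, ∑ u ∈ n v, ‖(f : L2 V) v - (f : L2 V) u‖ ^ 2 ≤
      (⟪(f : L2 V), laplacian G f⟫_ℂ).re := by
  -- With f = (1 + L)⁻¹g one has Lf = g − f, so both sides become continuous in g (the left side
  -- involves finitely many evaluations). It is then enough to take g in the dense range of 1 + L on
  -- finitely supported functions.
  have key : ∀ g : L2 V,
      ∑ v ∈ F, ∑ u ∈ n v, ‖resolvent G g v - resolvent G g u‖ ^ 2 ≤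
        (⟪resolvent G g, g - resolvent G g⟫_ℂ).re := by
    intro g
    refine (denseRange_finIncl_add_finLap G).induction_on
      (p := fun g => ∑ v ∈ F, ∑ u ∈ n v, ‖resolvent G g v - resolvent G g u‖ ^ 2 ≤
        (⟪resolvent G g, g - resolvent G g⟫_ℂ).re) g ?_ ?_
    · have hc : ∀ v, Continuous fun g : L2 V => resolvent G g v := fun v =>
        (continuous_eval v).comp (resolvent G).continuous
      refine isClosed_le ?_ (Complex.continuous_re.comp (by fun_prop))
      exact continuous_finsetSum _ fun v _ => continuous_finsetSum _ fun u _ =>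
        ((hc v).sub (hc u)).norm.pow 2
    · intro a
      rw [resolvent_apply_fin, LinearMap.add_apply, add_sub_cancel_left]
      exact sum_norm_sub_sq_le_finLap G n hadj hanti F a
  have := key ((f : L2 V) + laplacian G f)
  rwa [resolvent_left, add_sub_cancel_left] at this

end Energy

/-! ### Closedness and energy bound for band-limited vectors. -/

section Bandlimited

variable {H : Type*} [NormedAddCommGroup H] [InnerProductSpace ℂ H] {A : H →ₗ.[ℂ] H}
  (F : SpectralFourierTransform A)

theorem SpectralFourierTransform.bandlimited_mono {ω ω' : ℝ} (h : ω ≤ ω') :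
    F.bandlimited ω ≤ F.bandlimited ω' := fun f hf i => by
  filter_upwards [hf i] with t ht h'
  exact ht (h.trans_lt h')

/-- Vanishing almost everywhere on t > ω is the kernel condition for restriction to that set, a
continuous map on each summand. Closedness provides the completeness needed to invert the sampling
operator. -/
theorem SpectralFourierTransform.isClosed_bandlimited (ω : ℝ) :
    IsClosed (F.bandlimited ω : Set H) := by
  have hm : MeasurableSet {t : ℝ≥0 | ω < t} :=
    measurableSet_lt measurable_const measurable_coe_nnreal_real
  have : (F.bandlimited ω : Set H) = ⋂ i, {f | LpToLpRestrictCLM ℝ≥0 ℂ ℂ (F.μ i) 2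
      {t : ℝ≥0 | ω < t} (F.transform f i) = 0} := by
    ext f
    simp only [Set.mem_iInter, Set.mem_ofPred_eq]
    refine forall_congr' fun i => ?_
    refine (ae_restrict_iff' hm).symm.trans (Iff.trans ?_ (Lp.eq_zero_iff_ae_eq_zero).symm)
    have h := LpToLpRestrictCLM_coeFn (p := 2) ℂ {t : ℝ≥0 | ω < t} (F.transform f i)
    refine ⟨fun h' => ?_, fun h' => ?_⟩
    · filter_upwards [h, h'] with t h1 h2
      rw [h1, h2, Pi.zero_apply]
    · filter_upwards [h, h'] with t h1 h2
      rw [← h1, h2, Pi.zero_apply]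
  rw [this]
  refine isClosed_iInter fun i => isClosed_eq ?_ continuous_const
  refine (ContinuousLinearMap.continuous _).comp ?_
  exact ((continuous_apply i).comp (lp.uniformContinuous_coe (p := 2)
    (E := fun i => Lp ℂ 2 (F.μ i))).continuous).comp F.transform.continuous

/-- Cauchy–Schwarz and Bernstein. The latter needs a nonnegative bandwidth, so the band is first
enlarged to `max ω 0`; negative ω then needs no separate case. -/
theorem SpectralFourierTransform.bandlimited_energy {ω : ℝ} {f : H}
    (hf : f ∈ F.bandlimited ω) :
    ∃ h : f ∈ A.domain, (⟪f, A ⟨f, h⟩⟫_ℂ).re ≤ max ω 0 * ‖f‖ ^ 2 := by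
  obtain ⟨h, -, hle⟩ := F.bernstein (le_max_right ω 0) (F.bandlimited_mono (le_max_left ω 0) hf)
  refine ⟨h, ((Complex.re_le_norm _).trans (norm_inner_le_norm _ _)).trans ?_⟩
  nlinarith [norm_nonneg f]

end Bandlimited

/-! ### From frame bounds to a reconstruction series. -/

section Frame

/-- A bounded and bounded below weighted sampling operator on a closed subspace yields
an unconditionally convergent reconstruction formula. -/
theorem exists_hasSum_of_weighted_sampling {V : Type*} {S : Set V} {M : Submodule ℂ (L2 V)}
    (hM : IsClosed (M : Set (L2 V))) (m : S → ℂ) (C c : ℝ)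
    (hupper : ∀ f ∈ M, ∀ T : Finset S, ∑ w ∈ T, ‖m w * f w‖ ^ 2 ≤ C * ‖f‖ ^ 2)
    (hlower : ∀ f ∈ M, ∀ B : ℝ, (∀ T : Finset S, ∑ w ∈ T, ‖m w * f w‖ ^ 2 ≤ B) →
      ‖f‖ ^ 2 ≤ c * B) :
    ∃ Θ : S → L2 V, (∀ w, Θ w ∈ M) ∧ ∀ f ∈ M, HasSum (fun w : S => f w • Θ w) f := by
  classical
  have hmem : ∀ f : M, Memℓp (fun w : S => m w * (f : L2 V) w) 2 := fun f => by
    refine memℓp_gen' (C := C * ‖(f : L2 V)‖ ^ 2) fun T => ?_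
    simpa using hupper f f.2 T
  let R₀ : M →ₗ[ℂ] L2 S :=
    { toFun := fun f => ⟨fun w => m w * (f : L2 V) w, hmem f⟩
      map_add' := fun f g => by
        ext w
        exact mul_add _ _ _
      map_smul' := fun a f => by
        ext w
        exact mul_left_comm _ _ _ }
  have hR₀ : ∀ f w, R₀ f w = m w * (f : L2 V) w := fun _ _ => rfl
  -- For negative C the root is 0, and the upper bound then forces all the sample sums to be
  -- nonpositive.
  let R : M →L[ℂ] L2 S := R₀.mkContinuous (√ C) fun f => by
    refine lp.norm_le_of_forall_sum_le (by norm_num) (by positivity) fun T => ?_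
    have h := hupper f f.2 T
    rcases le_or_gt 0 C with hC | hC
    · simp only [ENNReal.toReal_ofNat, Real.rpow_ofNat, mul_pow, Real.sq_sqrt hC]
      exact h
    · have h0 : C * ‖(f : L2 V)‖ ^ 2 ≤ 0 := mul_nonpos_of_nonpos_of_nonneg hC.le (by positivity)
      simp only [ENNReal.toReal_ofNat, Real.rpow_ofNat, mul_pow]
      exact (h.trans h0).trans (by positivity)
  have hR : ∀ f w, R f w = m w * (f : L2 V) w := fun _ _ => rfl
  -- The lower bound is used with B = ‖R f‖². Being bounded below on a complete space makes R
  -- injective with closed range.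
  have hbelow : ∀ f : M, ‖f‖ ≤ (Real.toNNReal √ c : ℝ) * ‖R f‖ := fun f => by
    have h1 : ‖(f : L2 V)‖ ^ 2 ≤ c * ‖R f‖ ^ 2 := hlower f f.2 _ fun T => by
      simpa [hR] using lp.sum_rpow_le_norm_rpow (p := 2) (by norm_num) (R f) T
    rw [Real.coe_toNNReal _ (Real.sqrt_nonneg _)]
    have h2 := Real.sqrt_le_sqrt h1
    rw [Real.sqrt_sq (norm_nonneg _), Real.sqrt_mul' _ (by positivity),
      Real.sqrt_sq (norm_nonneg _)] at h2
    exact h2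
  have hanti := AddMonoidHomClass.antilipschitz_of_bound R hbelow
  have : CompleteSpace M := hM.completeSpace_coe
  have hclosed : IsClosed (Set.range R) := hanti.isClosed_range R.uniformContinuous
  have : CompleteSpace R.range := hclosed.completeSpace_coe
  let e := R.equivRange hanti.injective hclosed
  -- A left inverse of R defined on all of ℓ²(S): project onto the range, then invert there.
  let Φ : L2 S →L[ℂ] L2 V :=
    M.subtypeL ∘L (e.symm : R.range →L[ℂ] M) ∘L R.range.orthogonalProjectionOnto
  have hΦ : ∀ f : M, Φ (R f) = f := fun f => by
    have h1 : R.range.orthogonalProjectionOnto (R f) = e f :=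
      R.range.orthogonalProjectionOnto_mem_subspace_eq_self (e f)
    simp [Φ, h1]
  -- Putting the weight into Θ_w makes Φ send the coordinate term m(w)f(w)e_w of R f to f(w)Θ_w.
  -- Continuity of Φ preserves unconditional convergence.
  refine ⟨fun w => Φ (lp.single 2 w (m w)), fun w => ?_, fun f hf => ?_⟩
  · exact Subtype.coe_prop (e.symm (R.range.orthogonalProjectionOnto (lp.single 2 w (m w))))
  · have h := (lp.hasSum_single (p := 2) (by norm_num) (R ⟨f, hf⟩)).mapL Φ
    rw [hΦ] at h
    convert h using 2 with w
    rw [← map_smul, ← lp.single_smul, hR, smul_eq_mul, mul_comm]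

end Frame

/-! ### Selected neighbours and the two frame inequalities. -/

section Sampling

variable {V : Type*}

theorem sum_norm_sq_le (f : L2 V) (T : Finset V) : ∑ v ∈ T, ‖f v‖ ^ 2 ≤ ‖f‖ ^ 2 := by
  simpa using lp.sum_rpow_le_norm_rpow (p := 2) (by norm_num) f T

theorem norm_sq_le_of_forall_sum_le (f : L2 V) {B : ℝ} (h : ∀ T : Finset V, ∑ v ∈ T, ‖f v‖ ^ 2 ≤ B) :
    ‖f‖ ^ 2 ≤ B := by
  have := lp.hasSum_norm (p := 2) (by norm_num) f
  simp only [ENNReal.toReal_ofNat, Real.rpow_ofNat] at this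
  exact hasSum_le_of_sum_le this h

theorem norm_sq_le_two_mul (a b : ℂ) : ‖a‖ ^ 2 ≤ 2 * ‖a - b‖ ^ 2 + 2 * ‖b‖ ^ 2 := by
  have h : ‖a‖ ≤ ‖a - b‖ + ‖b‖ := by simpa using norm_add_le (a - b) b
  nlinarith [sq_nonneg (‖a - b‖ - ‖b‖), norm_nonneg a]

variable (G : SimpleGraph V) [G.LocallyFinite]

open Classical in
/-- The number of neighbours `v` of `u` whose selected set `n v` contains `u`. -/
noncomputable def selectionWeight (n : V → Finset V) (u : V) : ℕ :=
  {v ∈ G.neighborFinset u | u ∈ n v}.card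

variable {G}

-- Double counting: the vertices of F that select u are all neighbours of u, so `selectionWeight`
-- counts each of them.
open Classical in
theorem sum_selected_le_sum_weight {n : V → Finset V} (hadj : ∀ v, ∀ u ∈ n v, G.Adj v u)
    {a : V → ℝ} (ha : ∀ u, 0 ≤ a u) (F : Finset V) :
    ∑ v ∈ F, ∑ u ∈ n v, a u ≤ ∑ u ∈ F.biUnion n, selectionWeight G n u * a u := by
  rw [Finset.sum_comm' (t' := F.biUnion n) (s' := fun u => {v ∈ F | u ∈ n v})]
  · refine Finset.sum_le_sum fun u _ => ?_
    rw [Finset.sum_const, nsmul_eq_mul]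
    refine mul_le_mul_of_nonneg_right (Nat.cast_le.2 (Finset.card_le_card fun v hv => ?_)) (ha u)
    rw [Finset.mem_filter] at hv ⊢
    exact ⟨(G.mem_neighborFinset u v).2 (hadj v u hv.2).symm, hv.2⟩
  · intro v u
    simp only [Finset.mem_filter, Finset.mem_biUnion]
    exact ⟨fun h => ⟨h, v, h⟩, fun h => h.1⟩

-- Converse double counting: every vertex that selects some u ∈ T is adjacent to T, so summing over
-- all neighbours of T attains the full weight.
open Classical in
theorem sum_weight_le_sum_selected {n : V → Finset V}
    {a : V → ℝ} (ha : ∀ u, 0 ≤ a u) (T : Finset V) :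
    ∑ u ∈ T, selectionWeight G n u * a u ≤
      ∑ v ∈ T.biUnion (fun u => G.neighborFinset u), ∑ u ∈ n v, a u := by
  -- Neighbours of T may also select vertices outside T; those extra terms are nonnegative and are
  -- dropped.
  rw [Finset.sum_comm' (t' := T ∪ (T.biUnion fun u => G.neighborFinset u).biUnion n)
    (s' := fun u => {v ∈ T.biUnion (fun u => G.neighborFinset u) | u ∈ n v})]
  · simp only [Finset.sum_const, nsmul_eq_mul]
    have h1 : ∀ u ∈ T, selectionWeight G n u * a u ≤
        ({v ∈ T.biUnion (fun u => G.neighborFinset u) | u ∈ n v}.card : ℝ) * a u := fun u hu => by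
      refine mul_le_mul_of_nonneg_right (Nat.cast_le.2 (Finset.card_le_card fun v hv => ?_)) (ha u)
      rw [Finset.mem_filter] at hv ⊢
      exact ⟨Finset.mem_biUnion.2 ⟨u, hu, hv.1⟩, hv.2⟩
    refine (Finset.sum_le_sum h1).trans ?_
    exact Finset.sum_le_sum_of_subset_of_nonneg Finset.subset_union_left fun u _ _ =>
      mul_nonneg (Nat.cast_nonneg _) (ha u)
  · intro v u
    simp only [Finset.mem_filter, Finset.mem_union, Finset.mem_biUnion]
    exact ⟨fun h => ⟨h, Or.inr ⟨v, h⟩⟩, fun h => h.1⟩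

theorem isClosed_paleyWiener (ω : ℝ) : IsClosed (paleyWiener G ω : Set (L2 V)) :=
  (spectralFourierTransform G).isClosed_bandlimited ω

theorem sum_norm_sub_sq_le_of_mem_paleyWiener {n : V → Finset V}
    (hadj : ∀ v, ∀ u ∈ n v, G.Adj v u) (hanti : ∀ v, ∀ u ∈ n v, v ∉ n u) {ω : ℝ}
    {f : L2 V} (hf : f ∈ paleyWiener G ω) (F : Finset V) :
    ∑ v ∈ F, ∑ u ∈ n v, ‖f v - f u‖ ^ 2 ≤ max ω 0 * ‖f‖ ^ 2 := by
  obtain ⟨h, hle⟩ := (spectralFourierTransform G).bandlimited_energy hf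
  exact (sum_norm_sub_sq_le_laplacian G n hadj hanti F ⟨f, h⟩).trans hle

/-- Upper frame bound. Each f(u) is compared with f(v) for the vertices v that select u; the
differences cost energy, and each v is charged at most K times whatever the degree of u. -/
theorem sum_weight_mul_norm_sq_le {n : V → Finset V} {K : ℕ}
    (hadj : ∀ v, ∀ u ∈ n v, G.Adj v u) (hanti : ∀ v, ∀ u ∈ n v, v ∉ n u)
    (hcard : ∀ v, (n v).card ≤ K) {ω : ℝ} {f : L2 V} (hf : f ∈ paleyWiener G ω) (T : Finset V) :
    ∑ u ∈ T, selectionWeight G n u * ‖f u‖ ^ 2 ≤ (2 * max ω 0 + 2 * K) * ‖f‖ ^ 2 := by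
  classical
  refine (sum_weight_le_sum_selected (fun u => sq_nonneg ‖f u‖) T).trans ?_
  set F := T.biUnion fun u => G.neighborFinset u
  have h1 : ∑ v ∈ F, ∑ u ∈ n v, ‖f u‖ ^ 2 ≤
      ∑ v ∈ F, (2 * ∑ u ∈ n v, ‖f v - f u‖ ^ 2 + 2 * K * ‖f v‖ ^ 2) := by
    refine Finset.sum_le_sum fun v _ => ?_
    calc ∑ u ∈ n v, ‖f u‖ ^ 2 ≤ ∑ u ∈ n v, (2 * ‖f v - f u‖ ^ 2 + 2 * ‖f v‖ ^ 2) :=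
          Finset.sum_le_sum fun u _ => norm_sub_rev (f v) (f u) ▸ norm_sq_le_two_mul (f u) (f v)
      _ = 2 * ∑ u ∈ n v, ‖f v - f u‖ ^ 2 + (n v).card * (2 * ‖f v‖ ^ 2) := by
          rw [Finset.sum_add_distrib, Finset.mul_sum, Finset.sum_const, nsmul_eq_mul]
      _ ≤ _ := by
          have : ((n v).card : ℝ) ≤ K := Nat.cast_le.2 (hcard v)
          nlinarith [sq_nonneg ‖f v‖]
  rw [Finset.sum_add_distrib, ← Finset.mul_sum, ← Finset.mul_sum] at h1
  have h2 := sum_norm_sub_sq_le_of_mem_paleyWiener hadj hanti hf F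
  have h3 := mul_le_mul_of_nonneg_left (sum_norm_sq_le f F) (by positivity : (0 : ℝ) ≤ 2 * K)
  linarith

-- Core of the lower frame bound: f(v) is compared with each of its selected samples, and double
-- counting collects the samples with their weights.
open Classical in
theorem sum_card_mul_norm_sq_le {n : V → Finset V}
    (hadj : ∀ v, ∀ u ∈ n v, G.Adj v u) (hanti : ∀ v, ∀ u ∈ n v, v ∉ n u)
    {ω : ℝ} {f : L2 V} (hf : f ∈ paleyWiener G ω) (F : Finset V) :
    ∑ v ∈ F, (n v).card * ‖f v‖ ^ 2 ≤
      2 * (max ω 0 * ‖f‖ ^ 2) + 2 * ∑ u ∈ F.biUnion n, selectionWeight G n u * ‖f u‖ ^ 2 := by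
  have h1 : ∑ v ∈ F, (n v).card * ‖f v‖ ^ 2 ≤
      ∑ v ∈ F, (2 * ∑ u ∈ n v, ‖f v - f u‖ ^ 2 + 2 * ∑ u ∈ n v, ‖f u‖ ^ 2) := by
    refine Finset.sum_le_sum fun v _ => ?_
    rw [← nsmul_eq_mul, ← Finset.sum_const, Finset.mul_sum, Finset.mul_sum,
      ← Finset.sum_add_distrib]
    exact Finset.sum_le_sum fun u _ => norm_sq_le_two_mul (f v) (f u)
  rw [Finset.sum_add_distrib, ← Finset.mul_sum, ← Finset.mul_sum] at h1
  have h2 := sum_norm_sub_sq_le_of_mem_paleyWiener hadj hanti hf F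
  have h3 := sum_selected_le_sum_weight hadj (fun u => sq_nonneg ‖f u‖) F
  linarith

/-- If every vertex outside `S` has at least `K` neighbours in `S`, one can select exactly `K`
of them. -/
theorem exists_neighbor_selection {S : Set V} {K : ℕ}
    (hK : ∀ v, v ∉ S → K ≤ (G.neighborSet v ∩ S).ncard) :
    ∃ n : V → Finset V, (∀ v, ∀ u ∈ n v, G.Adj v u ∧ u ∈ S ∧ v ∉ S) ∧
      (∀ v, (n v).card ≤ K) ∧ ∀ v, v ∉ S → (n v).card = K := by
  have : ∀ v, ∃ s : Finset V, (∀ u ∈ s, G.Adj v u ∧ u ∈ S ∧ v ∉ S) ∧ s.card ≤ K ∧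
      (v ∉ S → s.card = K) := by
    intro v
    by_cases hv : v ∈ S
    -- Vertices of S select nothing, so no edge is selected from both ends.
    · exact ⟨∅, by simp, by simp, fun h => absurd hv h⟩
    · have hfin : (G.neighborSet v ∩ S).Finite := (Set.toFinite (G.neighborSet v)).inter_of_left S
      have hle := hK v hv
      rw [Set.ncard_eq_toFinset_card _ hfin] at hle
      obtain ⟨s, hs, hcard⟩ := Finset.exists_subset_card_eq hle
      refine ⟨s, fun u hu => ?_, hcard.le, fun _ => hcard⟩
      have := hfin.mem_toFinset.1 (hs hu)
      exact ⟨this.1, this.2, hv⟩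
  choose n h1 h2 h3 using this
  exact ⟨n, h1, h2, h3⟩

/-- Reconstruction of Paley-Wiener functions from samples: the samples at `u ∈ S`, weighted by
the square root of `1 + selectionWeight`, form a frame. -/
theorem exists_reconstruction {S : Set V} {K : ℕ} (hK₀ : 1 ≤ K)
    (hK : ∀ v, v ∉ S → K ≤ (G.neighborSet v ∩ S).ncard) {ω : ℝ} (hω : ω < K / 4) :
    ∃ Θ : S → L2 V, (∀ w, Θ w ∈ paleyWiener G ω) ∧
      ∀ f ∈ paleyWiener G ω, HasSum (fun w : S => f w • Θ w) f := by
  classical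
  obtain ⟨n, hn, hcard, hcard'⟩ := exists_neighbor_selection (G := G) hK
  have hadj : ∀ v, ∀ u ∈ n v, G.Adj v u := fun v u hu => (hn v u hu).1
  have hanti : ∀ v, ∀ u ∈ n v, v ∉ n u := fun v u hu h => (hn v u hu).2.2 (hn u v h).2.1
  have hm : ∀ (f : L2 V) (u : V), ‖((√(1 + selectionWeight G n u) : ℝ) : ℂ) * f u‖ ^ 2 =
      ‖f u‖ ^ 2 + selectionWeight G n u * ‖f u‖ ^ 2 := fun f u => by
    rw [norm_mul, mul_pow, Complex.norm_real, Real.norm_of_nonneg (Real.sqrt_nonneg _),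
      Real.sq_sqrt (by positivity)]
    ring
  -- The summand 1 in the weight controls f on S, where w may vanish. The constant 6 comes from
  -- solving ‖f‖² ≤ ‖f‖²/2 + 3B.
  refine exists_hasSum_of_weighted_sampling (isClosed_paleyWiener ω)
    (fun w : S => ((√(1 + selectionWeight G n w) : ℝ) : ℂ)) (1 + (2 * max ω 0 + 2 * K)) 6
    (fun f hf T => ?_) (fun f hf B hB => ?_)
  · simp only [hm]
    refine (Finset.sum_map T (Function.Embedding.subtype _)
      (fun u => ‖f u‖ ^ 2 + selectionWeight G n u * ‖f u‖ ^ 2)).ge.trans ?_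
    rw [Finset.sum_add_distrib]
    have h1 := sum_norm_sq_le f (T.map (Function.Embedding.subtype _))
    have h2 := sum_weight_mul_norm_sq_le hadj hanti hcard hf
      (T.map (Function.Embedding.subtype _))
    linarith
  · simp only [hm] at hB
    have hB' : ∀ T : Finset V, (∀ u ∈ T, u ∈ S) →
        ∑ u ∈ T, ‖f u‖ ^ 2 + ∑ u ∈ T, selectionWeight G n u * ‖f u‖ ^ 2 ≤ B := fun T hT => by
      rw [← Finset.sum_add_distrib, ← Finset.sum_subtype_of_mem _ hT]
      exact hB _
    have hw0 : ∀ T : Finset V, 0 ≤ ∑ u ∈ T, selectionWeight G n u * ‖f u‖ ^ 2 :=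
      fun T => Finset.sum_nonneg fun u _ => by positivity
    have hf0 : ∀ T : Finset V, 0 ≤ ∑ u ∈ T, ‖f u‖ ^ 2 :=
      fun T => Finset.sum_nonneg fun u _ => by positivity
    have hK1 : (1 : ℝ) ≤ K := Nat.one_le_cast.2 hK₀
    have hωK : max ω 0 ≤ K / 4 := max_le hω.le (by positivity)
    -- The part of f on S contributes at most B, the part outside S at most ‖f‖²/2 + 2B.
    have key : ‖f‖ ^ 2 ≤ ‖f‖ ^ 2 / 2 + 3 * B := by
      refine norm_sq_le_of_forall_sum_le f fun T => ?_
      have h1 := hB' {u ∈ T | u ∈ S} fun u hu => (Finset.mem_filter.1 hu).2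
      have h2 := sum_card_mul_norm_sq_le hadj hanti hf {u ∈ T | u ∉ S}
      have h3 := hB' ({u ∈ T | u ∉ S}.biUnion n) fun u hu => by
        obtain ⟨v, -, hv⟩ := Finset.mem_biUnion.1 hu
        exact (hn v u hv).2.1
      rw [Finset.sum_congr rfl fun v hv => by rw [hcard' v (Finset.mem_filter.1 hv).2],
        ← Finset.mul_sum] at h2
      rw [← Finset.sum_filter_add_sum_filter_not T (· ∈ S)]
      have h4 := mul_le_mul_of_nonneg_right hωK (sq_nonneg ‖f‖)
      have hB0 : 0 ≤ B := (add_nonneg (hf0 _) (hw0 _)).trans h1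
      have h5 : ∑ v ∈ T with v ∉ S, ‖f v‖ ^ 2 ≤ ‖f‖ ^ 2 / 2 + 2 * B := by
        -- Here ω ≤ K/4 turns 2 max(ω, 0)‖f‖² into at most K‖f‖²/2, and 1 ≤ K allows 2B ≤ 2KB.
        have h6 : (K : ℝ) * ∑ v ∈ T with v ∉ S, ‖f v‖ ^ 2 ≤ K * (‖f‖ ^ 2 / 2 + 2 * B) := by
          have := hf0 ({u ∈ T | u ∉ S}.biUnion n)
          nlinarith
        exact le_of_mul_le_mul_left h6 (by linarith)
      have := hw0 {u ∈ T | u ∈ S}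
      linarith
    linarith

end Sampling

end GraphSampling

/-! ### The sampling theorem. -/

theorem theorem3p4 {V : Type*} (G : SimpleGraph V) [G.LocallyFinite] (hG : G.Connected)
    (S : Set V) (K₀ : ℕ) (hK₀ : 1 ≤ K₀)
    (hS : S ∪ GraphSampling.vertexBoundary G S = Set.univ)
    (hK : ∀ v ∈ GraphSampling.vertexBoundary G S, K₀ ≤ (G.neighborSet v ∩ S).ncard)
    (ω : ℝ) (hω : ω < (K₀ : ℝ) / 4) :
    GraphSampling.IsUniquenessSet S (GraphSampling.paleyWiener G ω) ∧
    ∃ Θ : S → GraphSampling.L2 V,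
      (∀ w, Θ w ∈ GraphSampling.paleyWiener G ω) ∧
      ∀ f ∈ GraphSampling.paleyWiener G ω, HasSum (fun w : S => f w • Θ w) f := by
  obtain ⟨Θ, hΘ, hsum⟩ := GraphSampling.exists_reconstruction hK₀
    (fun v hv => hK v ((hS.ge (Set.mem_univ v)).resolve_left hv)) hω
  -- If f and g agree on S, their reconstruction series coincide term by term, hence so do the sums.
  refine ⟨fun f hf g hg hfg => (hsum f hf).unique ?_, Θ, hΘ, hsum⟩
  simpa only [hfg _ (Subtype.coe_prop _)] using hsum g hg
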